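/- Let $G$ be a finite group with identity $e$, and let $l:G\to\mathbb{R}$ be a length function, i.e. $l(e)=0$, $l(g^{-1})=l(g)$ and $l(g)\ge 0$ for all $g\in G$. Assume that $l$ is a class function: $l(h^{-1}gh)=l(g)$ for all $g,h\in G$. Let $\lambda$ be the left regular representation of $G$ on the space of complex functions on $G$, $(\lambda(g)f)(h)=f(g^{-1}h)$, and let $\mathcal{L}G$ be the complex linear span of the operators $\lambda(g)$, $g\in G$, which form a basis of it. For $t\ge 0$ let $P_t:\mathcal{L}G\to\mathcal{L}G$ be the linear map with $P_t\lambda(g)=e^{-t\,l(g)}\lambda(g)$. Let $\chi_1,\dots,\chi_m$ be the irreducible complex characters of $G$, with $\chi_1$ the trivial character, and let $\sigma_{\chi_i}:\mathcal{L}G\to\mathcal{L}G$ be the linear map with $\sigma_{\chi_i}\lambda(g)=\chi_i(g)\lambda(g)$. Let $C_1,\dots,C_m$ be the conjugacy classes of $G$, and write $l(C_j)$ and $\chi_{ij}=\chi_i(C_j)$ for the values of $l$ and $\chi_i$ on $C_j$. There are complex-valued functions $p_1,\dots,p_m$ of $t$ such that $P_t=\sum_{i=1}^m p_i(t)\,\sigma_{\chi_i}$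 for all $t\ge 0$ (the character-induced Kraus-like decomposition of $P_t$). They are uniquely determined for $t\ge 0$, namely $$p_i(t)=\sum_{j}\frac{\#C_j}{\#G}\,e^{-t\,l(C_j)}\,\overline{\chi_{ij}},$$ and their (right) derivatives at $t=0$ are $$p_i'(0)=-\sum_{j}\frac{\#C_j}{\#G}\,l(C_j)\,\overline{\chi_{ij}}.$$ The decomposition is called convex if $p_i(t)$ is real and nonnegative for all $i$ and all $t\ge 0$, and there are positive real numbers $\alpha_1,\dots,\alpha_m$, independent of $t$, with $\sum_i\alpha_i p_i(t)=1$ for all $t\ge 0$. The character-induced Kraus-like decomposition of $P_t$ is convex if and only if $$p_i'(0)=-\sum_{j}\frac{\#C_j}{\#G}\,l(C_j)\,\overline{\chi_{ij}}\ \ge\ 0\qquad\text{for all } i\ge 2.$$ -/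

import Mathlib

open scoped ComplexOrder ComplexConjugate

namespace KrausLike

/-- A length function on a group. -/
structure IsLengthFunction {G : Type*} [Group G] (l : G → ℝ) : Prop where
  map_one : l 1 = 0
  map_inv : ∀ g, l g⁻¹ = l g
  nonneg : ∀ g, 0 ≤ l g

/-- A function on a group that is constant on conjugacy classes. -/
def IsClassFunction {G α : Type*} [Group G] (f : G → α) : Prop :=
  ∀ g h : G, f (h⁻¹ * g * h) = f g

/-- The left regular representation of `G` on the space of complex functions on `G`,
`(lam g f) h = f (g⁻¹ * h)`. -/
def lam {G : Type*} [Group G] : Representation ℂ G (G → ℂ) where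
  toFun g :=
    { toFun := fun f h => f (g⁻¹ * h)
      map_add' := fun _ _ => rfl
      map_smul' := fun _ _ => rfl }
  map_one' := by
    ext f h
    simp
  map_mul' a b := by
    refine LinearMap.ext fun f => funext fun h => ?_
    simp [mul_assoc]

theorem lam_apply {G : Type*} [Group G] (g : G) (f : G → ℂ) (h : G) :
    lam g f h = f (g⁻¹ * h) := rfl

theorem linearIndependent_lam (G : Type*) [Group G] :
    LinearIndependent ℂ (fun g : G => (lam g : Module.End ℂ (G → ℂ))) := by
  classical
  rw [linearIndependent_iff']
  intro s c hc a ha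
  have h1 := congrFun (LinearMap.congr_fun hc (Pi.single 1 1)) a
  simp only [LinearMap.sum_apply, LinearMap.smul_apply, Finset.sum_apply, Pi.smul_apply,
    lam_apply, LinearMap.zero_apply, Pi.zero_apply, smul_eq_mul] at h1
  rw [Finset.sum_eq_single a] at h1
  · simpa using h1
  · intro b _ hb
    have hne : b⁻¹ * a ≠ 1 := fun h => hb (inv_mul_eq_one.mp h)
    simp [hne]
  · intro h
    exact absurd ha h

/-- The space `LG`: the complex linear span of the operators `lam g`. -/
abbrev LG (G : Type*) [Group G] : Submodule ℂ (Module.End ℂ (G → ℂ)) :=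
  Submodule.span ℂ (Set.range fun g : G => (lam g : Module.End ℂ (G → ℂ)))

/-- The basis of `LG` given by the left multipliers `lam g`. -/
noncomputable def lamBasis (G : Type*) [Group G] : Module.Basis G ℂ (LG G) :=
  Module.Basis.span (linearIndependent_lam G)

theorem coe_lamBasis {G : Type*} [Group G] (g : G) :
    (lamBasis G g : Module.End ℂ (G → ℂ)) = lam g :=
  congrArg Subtype.val (Module.Basis.span_apply (linearIndependent_lam G) g)

/-- The operator on `LG` with `lam g ↦ φ g • lam g`, extended linearly. -/
noncomputable def multiplier {G : Type*} [Group G] (φ : G → ℂ) : Module.End ℂ (LG G) :=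
  (lamBasis G).constr ℂ fun g => φ g • lamBasis G g

theorem multiplier_lamBasis {G : Type*} [Group G] (φ : G → ℂ) (g : G) :
    multiplier φ (lamBasis G g) = φ g • lamBasis G g :=
  Module.Basis.constr_basis _ _ _ _

/-- The operator `P_t` induced by `l`: `P_t (lam g) = exp (-t * l g) • lam g`. -/
noncomputable def semigroupOp {G : Type*} [Group G] (l : G → ℝ) (t : ℝ) : Module.End ℂ (LG G) :=
  multiplier fun g => (Real.exp (-t * l g) : ℂ)

/-- `χ` is the character of an irreducible finite-dimensional complex representation of `G`. -/
def IsIrreducibleCharacter {G : Type*} [Group G] (χ : G → ℂ) : Prop :=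
  ∃ (V : Type) (_ : AddCommGroup V) (_ : Module ℂ V) (_ : FiniteDimensional ℂ V)
    (ρ : Representation ℂ G V), ρ.IsIrreducible ∧ ρ.character = χ

/-- The set of irreducible complex characters of `G`. -/
abbrev IrrChar (G : Type*) [Group G] : Type _ := {χ : G → ℂ // IsIrreducibleCharacter χ}

/-- Orthonormality of the irreducible characters. -/
theorem irrChar_orthonormal {G : Type*} [Group G] [Fintype G] (χ ψ : IrrChar G) :
    ((χ = ψ → (Nat.card G : ℂ)⁻¹ * ∑ g : G, χ.1 g * ψ.1 g⁻¹ = 1) ∧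
      (χ ≠ ψ → (Nat.card G : ℂ)⁻¹ * ∑ g : G, χ.1 g * ψ.1 g⁻¹ = 0)) := by
  obtain ⟨χ, V, _, _, _, ρ, hρ, rfl⟩ := χ
  obtain ⟨ψ, W, _, _, _, τ, hτ, rfl⟩ := ψ
  have : Invertible (Nat.card G : ℂ) := invertibleOfNonzero (by simp)
  constructor
  · intro h
    have h' : ρ.character = τ.character := congrArg Subtype.val h
    have := Representation.char_orthonormal ρ ρ
    rw [if_pos ⟨Representation.Equiv.refl ρ⟩] at this
    simpa only [← h'] using this
  · intro h
    have := Representation.char_orthonormal ρ τ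
    rwa [if_neg] at this
    rintro ⟨e⟩
    exact h (Subtype.ext (Representation.char_iso e).symm)

theorem linearIndependent_irrChar (G : Type*) [Group G] [Fintype G] :
    LinearIndependent ℂ (fun χ : IrrChar G => χ.1) := by
  rw [linearIndependent_iff']
  intro s c hc ψ hψ
  have h : ∑ χ ∈ s, c χ * ((Nat.card G : ℂ)⁻¹ * ∑ g : G, χ.1 g * ψ.1 g⁻¹) = 0 := by
    have h1 : ∀ g, ∑ χ ∈ s, c χ * χ.1 g = 0 := fun g => by
      simpa using congrFun hc g
    calc ∑ χ ∈ s, c χ * ((Nat.card G : ℂ)⁻¹ * ∑ g : G, χ.1 g * ψ.1 g⁻¹)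
        = (Nat.card G : ℂ)⁻¹ * ∑ g : G, (∑ χ ∈ s, c χ * χ.1 g) * ψ.1 g⁻¹ := by
          simp only [Finset.mul_sum, Finset.sum_mul]
          rw [Finset.sum_comm]
          refine Finset.sum_congr rfl fun _ _ => Finset.sum_congr rfl fun _ _ => by ring
      _ = 0 := by simp [h1]
  rw [Finset.sum_eq_single ψ] at h
  · rwa [(irrChar_orthonormal ψ ψ).1 rfl, mul_one] at h
  · intro χ _ hχ
    rw [(irrChar_orthonormal χ ψ).2 hχ, mul_zero]
  · intro h'
    exact absurd hψ h'

instance finite_irrChar (G : Type*) [Group G] [Fintype G] : Finite (IrrChar G) :=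
  (linearIndependent_irrChar G).finite

noncomputable instance fintypeIrrChar (G : Type*) [Group G] [Fintype G] : Fintype (IrrChar G) :=
  Fintype.ofFinite _

/-- A Kraus-like operator decomposition `P_t = ∑ i, p i t • σ i` (for `t ≥ 0`) of a family of
operators on `LG`, with every `σ i` diagonal in the basis of left multipliers. -/
structure IsKrausLikeDecomposition {G ι : Type*} [Group G] [Fintype ι]
    (P : ℝ → Module.End ℂ (LG G)) (p : ι → ℝ → ℂ) (σ : ι → Module.End ℂ (LG G)) : Prop where
  diagonal : ∀ i g, ∃ c : ℂ, σ i (lamBasis G g) = c • lamBasis G g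
  eq_sum : ∀ t : ℝ, 0 ≤ t → P t = ∑ i, p i t • σ i

/-- A convex Kraus-like operator decomposition: the coefficients are nonnegative (in particular
real) and satisfy a sum rule with positive weights that do not depend on `t`. -/
structure IsConvexKrausLikeDecomposition {G ι : Type*} [Group G] [Fintype ι]
    (P : ℝ → Module.End ℂ (LG G)) (p : ι → ℝ → ℂ) (σ : ι → Module.End ℂ (LG G)) : Prop
    extends IsKrausLikeDecomposition P p σ where
  nonneg : ∀ t : ℝ, 0 ≤ t → ∀ i, 0 ≤ p i t
  sum_rule : ∃ α : ι → ℝ, (∀ i, 0 < α i) ∧ ∀ t : ℝ, 0 ≤ t → ∑ i, (α i : ℂ) * p i t = 1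

/-- The value of `f` on a conjugacy class, read off at a representative (for a class function,
the choice of the representative does not matter). -/
noncomputable def classValue {G α : Type*} [Group G] (f : G → α) (C : ConjClasses G) : α :=
  f C.exists_rep.choose

open scoped Classical in
/-- `∑ C, (#C / #G) * f C * conj (χ C)`, the sum over the conjugacy classes of `G`. -/
noncomputable def charPairing {G : Type*} [Group G] [Fintype G] (f : G → ℝ) (χ : G → ℂ) : ℂ :=
  ∑ C : ConjClasses G,
    ((Nat.card C.carrier : ℂ) / (Nat.card G : ℂ)) * ((classValue f C : ℝ) : ℂ) * conj (classValue χ C)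

end KrausLike

namespace KrausLike

section

variable {G : Type*} [Group G]

open Matrix in
theorem character_inv_eq_conj [Finite G] {V : Type*} [AddCommGroup V] [Module ℂ V]
    [FiniteDimensional ℂ V] (ρ : Representation ℂ G V) (g : G) :
    ρ.character g⁻¹ = conj (ρ.character g) := by
  have := Fintype.ofFinite G
  classical
  let b := Module.finBasis ℂ V
  let M : G → Matrix _ _ ℂ := fun g => LinearMap.toMatrix b b (ρ g)
  have hM : ∀ g h, M (g * h) = M g * M h := fun g h => by
    simp only [M, map_mul, LinearMap.toMatrix_mul]
  have hM1 : M 1 = 1 := by simp only [M, map_one, LinearMap.toMatrix_one]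
  let H := ∑ h, (M h)ᴴ * M h
  have hH : H.PosDef := by
    have : H = 1 + ∑ h ∈ Finset.univ.erase 1, (M h)ᴴ * M h := by
      simp only [H]
      rw [← Finset.add_sum_erase _ _ (Finset.mem_univ 1), hM1]
      simp
    rw [this]
    refine PosDef.one.add_posSemidef (posSemidef_sum _ fun h _ => ?_)
    exact posSemidef_conjTranspose_mul_self _
  have hinv : (M g)ᴴ * H * M g = H := by
    simp only [H, Finset.mul_sum, Finset.sum_mul]
    rw [← Equiv.sum_comp (Equiv.mulRight g) (fun h => (M h)ᴴ * M h)]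
    refine Finset.sum_congr rfl fun h _ => ?_
    simp [hM, mul_assoc]
  have hg : M g * M g⁻¹ = 1 := by rw [← hM, mul_inv_cancel, hM1]
  have hHu : H * H⁻¹ = 1 := mul_nonsing_inv _ ((isUnit_iff_isUnit_det _).1 hH.isUnit)
  have hHu' : H⁻¹ * H = 1 := nonsing_inv_mul _ ((isUnit_iff_isUnit_det _).1 hH.isUnit)
  have key : (M g)ᴴ = H * M g⁻¹ * H⁻¹ := by
    calc (M g)ᴴ = (M g)ᴴ * H * (M g * M g⁻¹) * H⁻¹ := by
          rw [hg, mul_one, mul_assoc, hHu, mul_one]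
      _ = _ := by rw [← mul_assoc, hinv]
  have tr : ∀ g, ρ.character g = (M g).trace := fun g =>
    LinearMap.trace_eq_matrix_trace ℂ b (ρ g)
  rw [tr, tr, starRingEnd_apply, ← trace_conjTranspose, key, trace_mul_comm, ← mul_assoc, hHu',
    one_mul]

theorem IsIrreducibleCharacter.map_inv [Finite G] {χ : G → ℂ} (h : IsIrreducibleCharacter χ)
    (g : G) : χ g⁻¹ = conj (χ g) := by
  obtain ⟨V, _, _, _, ρ, -, rfl⟩ := h
  exact character_inv_eq_conj ρ g

theorem IsIrreducibleCharacter.isClassFunction {χ : G → ℂ} (h : IsIrreducibleCharacter χ) :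
    IsClassFunction χ := by
  obtain ⟨V, _, _, _, ρ, -, rfl⟩ := h
  intro g h
  simpa using ρ.char_conj g h⁻¹

/-- The operator `∑ g, f g • ρ g⁻¹` attached to a function `f` on the group. -/
noncomputable def averageOp [Fintype G] {V : Type*} [AddCommGroup V] [Module ℂ V] (f : G → ℂ)
    (ρ : Representation ℂ G V) : Module.End ℂ V :=
  ∑ g, f g • ρ g⁻¹

theorem averageOp_apply [Fintype G] {V : Type*} [AddCommGroup V] [Module ℂ V] (f : G → ℂ)
    (ρ : Representation ℂ G V) (v : V) : averageOp f ρ v = ∑ g, f g • ρ g⁻¹ v := by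
  simp [averageOp]

theorem averageOp_comm [Fintype G] {V : Type*} [AddCommGroup V] [Module ℂ V] {f : G → ℂ}
    (hf : IsClassFunction f) (ρ : Representation ℂ G V) (h : G) (v : V) :
    averageOp f ρ (ρ h v) = ρ h (averageOp f ρ v) := by
  simp only [averageOp_apply, map_sum, map_smul]
  rw [← Equiv.sum_comp (MulAut.conj h).toEquiv]
  refine Finset.sum_congr rfl fun g _ => ?_
  have h1 : f (h * (g * h⁻¹)) = f g := by simpa [mul_assoc] using hf g h⁻¹
  simp [← Module.End.mul_apply, ← map_mul, h1, mul_assoc]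

theorem averageOp_eq_zero_of_isIrreducible [Fintype G] {V : Type} [AddCommGroup V] [Module ℂ V]
    [FiniteDimensional ℂ V] {f : G → ℂ} (hf : IsClassFunction f)
    (h0 : ∀ χ : IrrChar G, ∑ g, f g * χ.1 g⁻¹ = 0)
    (ρ : Representation ℂ G V) (hρ : ρ.IsIrreducible) : averageOp f ρ = 0 := by
  let F : Representation.IntertwiningMap ρ ρ :=
    ⟨averageOp f ρ, fun h => LinearMap.ext fun v => averageOp_comm hf ρ h v⟩
  obtain ⟨c, hc⟩ :=
    (Representation.IsIrreducible.algebraMap_intertwiningMap_bijective_of_isAlgClosed).2 F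
  have hc' : averageOp f ρ = c • LinearMap.id := by
    have := congrArg Representation.IntertwiningMap.toLinearMap hc
    refine Eq.trans this.symm (LinearMap.ext fun v => ?_)
    simp [Algebra.algebraMap_eq_smul_one]
  have htr : LinearMap.trace ℂ V (averageOp f ρ) = 0 := by
    rw [← h0 ⟨ρ.character, V, _, _, inferInstance, ρ, hρ, rfl⟩]
    simp [averageOp, Representation.character]
  rw [hc'] at htr ⊢
  rcases eq_or_ne c 0 with h | h
  · simp [h]
  · have : Module.finrank ℂ V = 0 := by simpa [h] using htr
    have := Module.finrank_zero_iff.1 this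
    exact Subsingleton.elim _ _

theorem isIrreducible_toRepresentation_of_isAtom {k V : Type*} [Field k] [AddCommGroup V]
    [Module k V] {ρ : Representation k G V} {σ : Subrepresentation ρ} (hσ : IsAtom σ) :
    σ.toRepresentation.IsIrreducible := by
  have hbot : ∀ τ : Subrepresentation σ.toRepresentation, τ.toSubmodule = ⊥ → τ = ⊥ :=
    fun τ h => Subrepresentation.toSubmodule_injective h
  refine { exists_pair_ne := ⟨⊥, ⊤, fun h => hσ.1 ?_⟩, eq_bot_or_eq_top := fun τ => ?_ }
  · refine Subrepresentation.toSubmodule_injective ((Submodule.eq_bot_iff _).2 fun x hx => ?_)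
    have h1 : (⊤ : Submodule k σ.toSubmodule) = ⊥ :=
      (congrArg Subrepresentation.toSubmodule h).symm
    have h2 : (⟨x, hx⟩ : σ.toSubmodule) ∈ (⊥ : Submodule k σ.toSubmodule) := h1 ▸ Submodule.mem_top
    exact congrArg Subtype.val ((Submodule.mem_bot k).1 h2)
  · let τ' : Subrepresentation ρ :=
      { toSubmodule := τ.toSubmodule.map σ.toSubmodule.subtype
        apply_mem_toSubmodule := by
          rintro g _ ⟨x, hx, rfl⟩
          exact ⟨_, τ.apply_mem_toSubmodule g hx, rfl⟩ }
    have hle : τ' ≤ σ := by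
      rintro _ ⟨x, hx, rfl⟩
      exact x.2
    rcases hσ.le_iff.1 hle with h | h
    · left
      refine Subrepresentation.toSubmodule_injective ?_
      have h1 : τ.toSubmodule.map σ.toSubmodule.subtype = ⊥ :=
        congrArg Subrepresentation.toSubmodule h
      exact Submodule.map_injective_of_injective Subtype.val_injective (h1.trans (Submodule.map_bot _).symm)
    · right
      refine Subrepresentation.toSubmodule_injective ?_
      have h1 : τ.toSubmodule.map σ.toSubmodule.subtype = σ.toSubmodule :=
        congrArg Subrepresentation.toSubmodule h
      refine (Submodule.eq_top_iff'.2 fun x => ?_)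
      have hx : x.1 ∈ τ.toSubmodule.map σ.toSubmodule.subtype := by
        rw [h1]
        exact x.2
      obtain ⟨y, hy, hyx⟩ := hx
      rwa [← Subtype.ext hyx]

theorem averageOp_eq_zero [Fintype G] {V : Type} [AddCommGroup V] [Module ℂ V]
    [FiniteDimensional ℂ V] {f : G → ℂ} (hf : IsClassFunction f)
    (h0 : ∀ χ : IrrChar G, ∑ g, f g * χ.1 g⁻¹ = 0) (ρ : Representation ℂ G V) :
    averageOp f ρ = 0 := by
  let K : Subrepresentation ρ :=
    { toSubmodule := LinearMap.ker (averageOp f ρ)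
      apply_mem_toSubmodule := fun g v hv => by
        rw [LinearMap.mem_ker] at hv ⊢
        rw [averageOp_comm hf, hv, map_zero] }
  have : NeZero (Nat.card G : ℂ) := ⟨by simp⟩
  suffices h : Subrepresentation.subrepresentationSubmoduleOrderIso K = ⊤ by
    have h1 : K = ⊤ := (map_eq_top_iff Subrepresentation.subrepresentationSubmoduleOrderIso).1 h
    exact LinearMap.ker_eq_top.1 (congrArg Subrepresentation.toSubmodule h1)
  rw [eq_top_iff, ← IsSemisimpleModule.sSup_simples_eq_top]
  refine sSup_le fun m hm => ?_
  have hm' : IsAtom m := isSimpleModule_iff_isAtom.1 hm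
  rw [← OrderIso.symm_apply_le]
  set σ := Subrepresentation.subrepresentationSubmoduleOrderIso.symm m with hσ
  have hat : IsAtom σ := (OrderIso.isAtom_iff _ _).2 hm'
  have hz := averageOp_eq_zero_of_isIrreducible hf h0 σ.toRepresentation
    (isIrreducible_toRepresentation_of_isAtom hat)
  intro v hv
  have h2 := congrArg Subtype.val (LinearMap.congr_fun hz ⟨v, hv⟩)
  rw [averageOp_apply] at h2
  change averageOp f ρ v = 0
  rw [averageOp_apply]
  simpa [Subrepresentation.toRepresentation] using h2

/-- A class function orthogonal to all irreducible characters vanishes. -/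
theorem IsClassFunction.eq_zero_of_forall_irrChar [Fintype G] {f : G → ℂ}
    (hf : IsClassFunction f) (h0 : ∀ χ : IrrChar G, ∑ g, f g * χ.1 g⁻¹ = 0) : f = 0 := by
  classical
  let e : (G → ℂ) ≃ₗ[ℂ] (Fin (Fintype.card G) → ℂ) :=
    LinearEquiv.funCongrLeft ℂ ℂ (Fintype.equivFin G).symm
  let ρ : Representation ℂ G (Fin (Fintype.card G) → ℂ) :=
    { toFun := fun g => e.conj (lam g)
      map_one' := by rw [map_one]; exact LinearEquiv.conj_id e
      map_mul' := fun a b => by rw [map_mul]; exact LinearEquiv.conj_comp e _ _ }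
  have h := averageOp_eq_zero hf h0 ρ
  funext g
  have h1 := LinearMap.congr_fun h (e (Pi.single 1 1))
  rw [averageOp_apply] at h1
  have h2 : ∀ x, ρ x (e (Pi.single 1 1)) = e (lam x (Pi.single 1 1)) := fun x => by
    simp [ρ, LinearEquiv.conj_apply]
  simp only [h2, ← map_smul, ← map_sum] at h1
  have h3 := congrFun (e.injective (h1.trans (map_zero e).symm)) g⁻¹
  rw [Finset.sum_apply, Finset.sum_eq_single g] at h3
  · simpa [lam_apply] using h3
  · intro b _ hb
    have : b * g⁻¹ ≠ 1 := fun h => hb (mul_inv_eq_one.1 h)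
    simp [lam_apply, this]
  · simp

end

section

variable {G : Type*} [Group G] [Fintype G]

theorem IsClassFunction.eq_of_isConj {G α : Type*} [Group G] {f : G → α} (hf : IsClassFunction f)
    {a b : G} (h : IsConj a b) : f a = f b := by
  obtain ⟨c, rfl⟩ := isConj_iff.1 h
  simpa using (hf a c⁻¹).symm

theorem IsClassFunction.classValue_mk {G α : Type*} [Group G] {f : G → α} (hf : IsClassFunction f)
    (g : G) : classValue f (ConjClasses.mk g) = f g :=
  hf.eq_of_isConj (ConjClasses.mk_eq_mk_iff_isConj.1 (ConjClasses.mk g).exists_rep.choose_spec)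

/-- The coefficient of `f` at the character `χ`, as a linear functional of `f`. -/
noncomputable def coeff (χ : G → ℂ) : (G → ℂ) →ₗ[ℂ] ℂ :=
  (Nat.card G : ℂ)⁻¹ • ∑ g : G, χ g⁻¹ • LinearMap.proj g

theorem coeff_apply (χ f : G → ℂ) :
    coeff χ f = (Nat.card G : ℂ)⁻¹ * ∑ g : G, f g * χ g⁻¹ := by
  simp [coeff, mul_comm]

open scoped Classical in
theorem coeff_irrChar (χ ψ : IrrChar G) : coeff ψ.1 χ.1 = if χ = ψ then 1 else 0 := by
  rw [coeff_apply]
  split_ifs with h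
  · exact (irrChar_orthonormal χ ψ).1 h
  · exact (irrChar_orthonormal χ ψ).2 h

theorem coeff_sum_smul_irrChar (c : IrrChar G → ℂ) (ψ : IrrChar G) :
    coeff ψ.1 (∑ χ : IrrChar G, c χ • χ.1) = c ψ := by
  classical
  simp [coeff_irrChar]

theorem IsClassFunction.sum {G α ι : Type*} [Group G] [AddCommMonoid α] {f : ι → G → α} {s : Finset ι}
    (hf : ∀ i ∈ s, IsClassFunction (f i)) : IsClassFunction (∑ i ∈ s, f i) := fun g h => by
  simp only [Finset.sum_apply]
  exact Finset.sum_congr rfl fun i hi => hf i hi g h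

/-- The expansion of a class function in irreducible characters. -/
theorem IsClassFunction.sum_coeff_smul {f : G → ℂ} (hf : IsClassFunction f) :
    ∑ χ : IrrChar G, coeff χ.1 f • χ.1 = f := by
  rw [← sub_eq_zero]
  set F := ∑ χ : IrrChar G, coeff χ.1 f • χ.1 with hF
  have hFc : IsClassFunction F := IsClassFunction.sum fun χ _ g h => by
    simp [χ.2.isClassFunction g h]
  refine IsClassFunction.eq_zero_of_forall_irrChar
    (fun g h => by simp [hf g h, hFc g h]) fun ψ => ?_
  have h1 : coeff ψ.1 (F - f) = 0 := by
    rw [map_sub, hF, coeff_sum_smul_irrChar, sub_self]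
  rw [coeff_apply] at h1
  exact (mul_eq_zero.1 h1).resolve_left (by simp)

theorem charPairing_eq_coeff {f : G → ℝ} (hf : IsClassFunction f) {χ : G → ℂ}
    (hχ : IsIrreducibleCharacter χ) : charPairing f χ = coeff χ (fun g => (f g : ℂ)) := by
  classical
  rw [charPairing, coeff_apply, ← Finset.sum_fiberwise Finset.univ ConjClasses.mk
    (fun g => (f g : ℂ) * χ g⁻¹), Finset.mul_sum]
  refine Finset.sum_congr (by congr!) fun C _ => ?_
  obtain ⟨a, rfl⟩ := C.exists_rep
  rw [hf.classValue_mk, hχ.isClassFunction.classValue_mk]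
  have h : ∀ g ∈ Finset.univ.filter (fun g => ConjClasses.mk g = ConjClasses.mk a),
      (f g : ℂ) * χ g⁻¹ = f a * conj (χ a) := fun g hg => by
    have hg' := ConjClasses.mk_eq_mk_iff_isConj.1 (Finset.mem_filter.1 hg).2
    rw [hχ.map_inv, hf.eq_of_isConj hg', hχ.isClassFunction.eq_of_isConj hg']
  refine Eq.trans ?_ (congrArg _ (Finset.sum_congr rfl h).symm)
  have hcard : Nat.card (ConjClasses.mk a).carrier =
      (Finset.univ.filter (fun g => ConjClasses.mk g = ConjClasses.mk a)).card := by
    rw [Nat.card_eq_fintype_card, Fintype.card_subtype]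
    simp only [ConjClasses.mem_carrier_iff_mk_eq]
  rw [Finset.sum_const, nsmul_eq_mul, ← hcard]
  ring

/-- A class function that is a nonnegative combination of irreducible characters. -/
structure IsPositive (f : G → ℂ) : Prop where
  isClassFunction : IsClassFunction f
  coeff_nonneg : ∀ χ : IrrChar G, 0 ≤ coeff χ.1 f

theorem coeff_character_nonneg {V W : Type*} [AddCommGroup V] [Module ℂ V] [FiniteDimensional ℂ V]
    [AddCommGroup W] [Module ℂ W] [FiniteDimensional ℂ W] (ρ : Representation ℂ G V)
    (σ : Representation ℂ G W) : 0 ≤ coeff ρ.character σ.character := by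
  have : Invertible (Nat.card G : ℂ) := invertibleOfNonzero (by simp)
  rw [coeff_apply, Representation.card_inv_mul_sum_char_mul_char_eq_finrank]
  exact Nat.cast_nonneg _

theorem coeff_mul_irrChar_nonneg (χ ψ φ : IrrChar G) : 0 ≤ coeff φ.1 (χ.1 * ψ.1) := by
  obtain ⟨_, V, _, _, _, ρ, -, rfl⟩ := χ
  obtain ⟨_, W, _, _, _, σ, -, rfl⟩ := ψ
  obtain ⟨_, U, _, _, _, τ, -, rfl⟩ := φ
  rw [← Representation.char_tensor]
  exact coeff_character_nonneg _ _

theorem IsPositive.mul {f h : G → ℂ} (hf : IsPositive f) (hh : IsPositive h) :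
    IsPositive (f * h) where
  isClassFunction a b := by simp [hf.1 a b, hh.1 a b]
  coeff_nonneg φ := by
    rw [← hf.1.sum_coeff_smul, ← hh.1.sum_coeff_smul, Finset.sum_mul_sum, map_sum]
    refine Finset.sum_nonneg fun χ _ => ?_
    rw [map_sum]
    refine Finset.sum_nonneg fun ψ _ => ?_
    rw [smul_mul_smul_comm, map_smul]
    exact mul_nonneg (mul_nonneg (hf.2 χ) (hh.2 ψ)) (coeff_mul_irrChar_nonneg χ ψ φ)

theorem isIrreducibleCharacter_one (G : Type*) [Group G] :
    IsIrreducibleCharacter (fun _ : G => 1) := by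
  refine ⟨ℂ, _, _, inferInstance, Representation.trivial ℂ G ℂ, ?_, ?_⟩
  · refine { exists_pair_ne := ⟨⊥, ⊤, fun h => ?_⟩, eq_bot_or_eq_top := fun τ => ?_ }
    · exact bot_ne_top (α := Submodule ℂ ℂ) (congrArg Subrepresentation.toSubmodule h)
    · exact (eq_bot_or_eq_top τ.toSubmodule).imp
        (fun h => Subrepresentation.toSubmodule_injective h)
        (fun h => Subrepresentation.toSubmodule_injective h)
  · funext g
    simp [Representation.character]

/-- The trivial character. -/
def trivialChar (G : Type*) [Group G] : IrrChar G := ⟨fun _ => 1, isIrreducibleCharacter_one G⟩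

theorem isPositive_one : IsPositive (1 : G → ℂ) where
  isClassFunction _ _ := rfl
  coeff_nonneg χ := by
    classical
    change 0 ≤ coeff χ.1 (trivialChar G).1
    rw [coeff_irrChar]
    split_ifs
    exacts [zero_le_one, le_rfl]

theorem IsPositive.pow {f : G → ℂ} (hf : IsPositive f) (n : ℕ) : IsPositive (f ^ n) := by
  induction n with
  | zero => simpa using isPositive_one
  | succ n ih => exact pow_succ f n ▸ ih.mul hf

theorem IsPositive.coeff_exp_nonneg {f : G → ℂ} (hf : IsPositive f) (χ : IrrChar G) :
    0 ≤ coeff χ.1 (fun g => Complex.exp (f g)) := by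
  have h : HasSum (fun n : ℕ => ((n.factorial : ℂ)⁻¹) • f ^ n) (fun g => Complex.exp (f g)) := by
    refine Pi.hasSum.2 fun g => ?_
    have h1 := NormedSpace.exp_series_hasSum_exp' (𝕂 := ℂ) (f g)
    rw [← Complex.exp_eq_exp_ℂ] at h1
    simpa only [Pi.smul_apply, Pi.pow_apply] using h1
  have h' := h.mapL (LinearMap.toContinuousLinearMap (coeff χ.1))
  refine h'.nonneg fun n => ?_
  simp only [LinearMap.coe_toContinuousLinearMap', map_smul, smul_eq_mul]
  refine mul_nonneg ?_ ((hf.pow n).2 χ)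
  rw [← Complex.ofReal_natCast, ← Complex.ofReal_inv]
  exact Complex.zero_le_real.2 (by positivity)

end

section

variable {G : Type*} [Group G] [Fintype G] {l : G → ℝ}

theorem IsClassFunction.comp {G α β : Type*} [Group G] {f : G → α} (hf : IsClassFunction f)
    (φ : α → β) : IsClassFunction (fun g => φ (f g)) := fun g h => congrArg φ (hf g h)

theorem multiplier_eq_sum_iff {G ι : Type*} [Group G] [Fintype ι] (φ : G → ℂ) (c : ι → ℂ)
    (ψ : ι → G → ℂ) : multiplier φ = ∑ i, c i • multiplier (ψ i) ↔ φ = ∑ i, c i • ψ i := by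
  have h1 : ∀ g, (∑ i, c i • multiplier (ψ i)) (lamBasis G g) =
      (∑ i, c i • ψ i) g • lamBasis G g := fun g => by
    simp [multiplier_lamBasis, Finset.sum_smul, smul_smul]
  constructor
  · intro h
    funext g
    have h2 := LinearMap.congr_fun h (lamBasis G g)
    rw [h1, multiplier_lamBasis] at h2
    simpa only [map_smul, Module.Basis.repr_self, Finsupp.smul_single, smul_eq_mul, mul_one,
      Finsupp.single_eq_same] using congrArg (fun x => (lamBasis G).repr x g) h2
  · intro h
    refine (lamBasis G).ext fun g => ?_
    rw [h1, multiplier_lamBasis, ← h]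

theorem isKrausLikeDecomposition_iff (hc : IsClassFunction l) (p : IrrChar G → ℝ → ℂ) :
    IsKrausLikeDecomposition (semigroupOp l) p (fun χ => multiplier χ.1) ↔
      ∀ (χ : IrrChar G) (t : ℝ), 0 ≤ t →
        p χ t = coeff χ.1 (fun g => (Real.exp (-t * l g) : ℂ)) := by
  constructor
  · intro h χ t ht
    rw [(multiplier_eq_sum_iff _ (fun χ => p χ t) (fun χ : IrrChar G => χ.1)).1 (h.eq_sum t ht),
      coeff_sum_smul_irrChar]
  · intro h
    refine ⟨fun χ g => ⟨_, multiplier_lamBasis _ _⟩, fun t ht => ?_⟩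
    refine (multiplier_eq_sum_iff _ (fun χ => p χ t) (fun χ : IrrChar G => χ.1)).2 ?_
    simp only [h _ t ht]
    exact (hc.comp fun x => (Real.exp (-t * x) : ℂ)).sum_coeff_smul.symm

theorem hasDerivAt_coeff_exp (χ : G → ℂ) (l : G → ℝ) :
    HasDerivAt (fun t : ℝ => coeff χ (fun g => (Real.exp (-t * l g) : ℂ)))
      (-coeff χ (fun g => (l g : ℂ))) 0 := by
  have h : HasDerivAt (fun t : ℝ => fun g => (Real.exp (-t * l g) : ℂ))
      (-fun g => (l g : ℂ)) 0 := by
    refine hasDerivAt_pi.2 fun g => ?_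
    have h1 := (((hasDerivAt_id (0 : ℝ)).neg.mul_const (l g)).exp).ofReal_comp
    simpa using h1
  rw [← map_neg]
  exact ((LinearMap.toContinuousLinearMap (coeff χ)).restrictScalars ℝ).hasFDerivAt.comp_hasDerivAt
    0 h

theorem nonneg_of_hasDerivWithinAt {f : ℝ → ℂ} {d : ℂ}
    (hf : HasDerivWithinAt f d (Set.Ici 0) 0) (h0 : f 0 = 0) (h : ∀ t, 0 ≤ t → 0 ≤ f t) :
    0 ≤ d := by
  have h1 := (hasDerivWithinAt_iff_tendsto_slope' (by simp)).1 hf.Ioi_of_Ici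
  refine ge_of_tendsto h1 (Filter.eventually_of_mem self_mem_nhdsWithin fun t ht => ?_)
  have ht' : (0 : ℝ) < t := ht
  rw [slope_def_module, h0, sub_zero, sub_zero]
  exact smul_nonneg (inv_nonneg.2 ht'.le) (h t ht'.le)

theorem coeff_one_eq_zero (χ : IrrChar G) (hχ : χ.1 ≠ fun _ => 1) :
    coeff χ.1 (fun _ => 1) = 0 := by
  classical
  have := coeff_irrChar (trivialChar G) χ
  rwa [if_neg fun h => hχ (congrArg Subtype.val h).symm] at this

theorem coeff_exp_nonneg (hc : IsClassFunction l)
    (h : ∀ χ : IrrChar G, χ.1 ≠ (fun _ => 1) → 0 ≤ -coeff χ.1 (fun g => (l g : ℂ)))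
    (χ : IrrChar G) {t : ℝ} (ht : 0 ≤ t) :
    0 ≤ coeff χ.1 (fun g => (Real.exp (-t * l g) : ℂ)) := by
  classical
  set a : ℝ := (Nat.card G : ℝ)⁻¹ * ∑ g, l g with ha
  have haC : coeff (fun _ => 1) (fun g => (l g : ℂ)) = a := by
    simp [coeff_apply, ha]
  let f : G → ℂ := (t : ℂ) • ((a : ℂ) • (fun _ => 1) - fun g => (l g : ℂ))
  have hf : IsPositive f := by
    refine ⟨fun g k => by simp [f, hc g k], fun ψ => ?_⟩
    rw [map_smul, map_sub, map_smul]
    refine smul_nonneg (Complex.zero_le_real.2 ht) ?_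
    by_cases hψ : ψ.1 = fun _ => 1
    · have h1 : coeff ψ.1 (fun _ => 1) = 1 := by
        simpa [hψ] using coeff_irrChar ψ ψ
      rw [h1, hψ, haC]
      simp
    · rw [coeff_one_eq_zero ψ hψ, smul_zero, zero_sub]
      exact h ψ hψ
  have hexp : (fun g => (Real.exp (-t * l g) : ℂ)) =
      (Real.exp (-t * a) : ℂ) • fun g => Complex.exp (f g) := by
    funext g
    simp only [Pi.smul_apply, smul_eq_mul, f, Complex.ofReal_exp, ← Complex.exp_add, Pi.sub_apply]
    congr 1
    push_cast
    ring
  rw [hexp, map_smul]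
  exact smul_nonneg (Complex.zero_le_real.2 (Real.exp_pos _).le) (hf.coeff_exp_nonneg χ)

theorem IsIrreducibleCharacter.exists_map_one {G : Type*} [Group G] {χ : G → ℂ}
    (h : IsIrreducibleCharacter χ) : ∃ n : ℕ, 0 < n ∧ χ 1 = n := by
  obtain ⟨V, _, _, _, ρ, hρ, rfl⟩ := h
  refine ⟨Module.finrank ℂ V, ?_, ρ.char_one⟩
  rw [Module.finrank_pos_iff]
  by_contra hV
  rw [not_nontrivial_iff_subsingleton] at hV
  exact bot_ne_top (α := Subrepresentation ρ)
    (Subrepresentation.toSubmodule_injective (Subsingleton.elim _ _))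

end

end KrausLike

theorem mainTheorem1 {G : Type*} [Group G] [Fintype G] (l : G → ℝ)
    (hl : KrausLike.IsLengthFunction l) (hc : KrausLike.IsClassFunction l) :
    -- the character-induced decomposition exists
    (∃ p : KrausLike.IrrChar G → ℝ → ℂ,
      KrausLike.IsKrausLikeDecomposition (KrausLike.semigroupOp l) p
        (fun χ => KrausLike.multiplier χ.1)) ∧
    ∀ p : KrausLike.IrrChar G → ℝ → ℂ,
      KrausLike.IsKrausLikeDecomposition (KrausLike.semigroupOp l) p
        (fun χ => KrausLike.multiplier χ.1) →
      -- its coefficients are unique, and given by the following formula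
      (∀ (χ : KrausLike.IrrChar G) (t : ℝ), 0 ≤ t →
        p χ t = KrausLike.charPairing (fun g => Real.exp (-t * l g)) χ.1) ∧
      -- their derivatives at zero
      (∀ χ : KrausLike.IrrChar G,
        HasDerivWithinAt (p χ) (-KrausLike.charPairing l χ.1) (Set.Ici 0) 0) ∧
      -- convexity is equivalent to the linear constraints
      (KrausLike.IsConvexKrausLikeDecomposition (KrausLike.semigroupOp l) p
          (fun χ => KrausLike.multiplier χ.1) ↔
        ∀ χ : KrausLike.IrrChar G, χ.1 ≠ (fun _ => 1) →
          0 ≤ -KrausLike.charPairing l χ.1) := by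
  open KrausLike in
  refine ⟨⟨_, (isKrausLikeDecomposition_iff hc _).2 fun χ t _ => rfl⟩, fun p hp => ?_⟩
  have hpt := (isKrausLikeDecomposition_iff hc p).1 hp
  have hpair : ∀ χ : IrrChar G, charPairing l χ.1 = coeff χ.1 (fun g => (l g : ℂ)) :=
    fun χ => charPairing_eq_coeff hc χ.2
  have hderiv : ∀ χ : IrrChar G,
      HasDerivWithinAt (p χ) (-charPairing l χ.1) (Set.Ici 0) 0 := fun χ => by
    rw [hpair]
    exact (hasDerivAt_coeff_exp χ.1 l).hasDerivWithinAt.congr (fun t ht => hpt χ t ht)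
      (hpt χ 0 le_rfl)
  refine ⟨fun χ t ht => ?_, hderiv, fun h χ hχ => ?_, fun h => ?_⟩
  · rw [hpt χ t ht, charPairing_eq_coeff (hc.comp fun x => Real.exp (-t * x)) χ.2]
  · refine nonneg_of_hasDerivWithinAt (hderiv χ) ?_ fun t ht => h.nonneg t ht χ
    rw [hpt χ 0 le_rfl]
    simpa using coeff_one_eq_zero χ hχ
  · simp only [hpair] at h
    refine { hp with
      nonneg := fun t ht χ => ?_
      sum_rule := ?_ }
    · rw [hpt χ t ht]
      exact coeff_exp_nonneg hc h χ ht
    · choose n hn hχn using fun χ : IrrChar G => χ.2.exists_map_one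
      refine ⟨fun χ => n χ, fun χ => Nat.cast_pos.2 (hn χ), fun t ht => ?_⟩
      have h1 := congrFun (hc.comp fun x => (Real.exp (-t * x) : ℂ)).sum_coeff_smul 1
      rw [hl.map_one] at h1
      simpa [hpt _ t ht, hχn, mul_comm] using h1
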